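/- Charts. A chart consists of a finite set $V$ of vertices, possibly containing a special termination vertex $\surd$ that has no outgoing transitions, a start vertex $v_s \in V\setminus\{\surd\}$, a set $A$ of actions, and a set $T \subseteq V\times A\times V$ of transitions, such that every vertex is reachable from $v_s$. Collapse. A bisimulation between two charts is a relation $B$ between their vertices that relates the start vertices and such that, whenever $v_1 \mathrel{B} v_2$: every transition $v_1 \xrightarrow{a} v_1'$ is matched by a transition $v_2 \xrightarrow{a} v_2'$ with $v_1' \mathrel{B} v_2'$; every transition $v_2 \xrightarrow{a} v_2'$ is matched by a transition $v_1 \xrightarrow{a} v_1'$ with $v_1' \mathrel{B} v_2'$; and $v_1=\surd$ if and only if $v_2=\surd$. Two vertices of a chart $\mathcal{C}$ are bisimilar if they are related by some bisimulation between $\mathcal{C}$ and itself. The bisimulation collapse of $\mathcal{C}$ is the quotient chart of $\mathcal{C}$ by bisimilarity of vertices: its vertices are the bisimilarity classes, its start vertex is the class of $v_s$, its termination vertex is the class of $\surd$ (if $\surd\in V$), and its transitions are all $[v]\xrightarrow{a}[w]$ such that $v\xrightarrow{a}w$ is a transition of $\mathcal{C}$. LLEE-charts. A loop chart is a chart such that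 there is an infinite path from its start vertex, every infinite path from its start vertex returns to the start vertex after a positive number of transitions, and $\surd$ is not among its vertices. An entry/body-labeling $\hat{\mathcal{C}}$ of a chart $\mathcal{C}$ assigns to each transition of $\mathcal{C}$ a marking label in $\mathbb{N}$; transitions with label $0$ are body transitions, and transitions with label $\alpha\ge 1$ are $\alpha$-entry transitions. If an $\alpha$-entry transition departs from $v$, then $\mathcal{C}_{\hat{\mathcal{C}}}(v,\alpha)$ denotes the chart with start vertex $v$ that consists of the vertices and transitions on paths in $\mathcal{C}$ that start with an $\alpha$-entry transition from $v$, continue with body transitions only, and halt immediately if $v$ is revisited. The labeling $\hat{\mathcal{C}}$ is a LLEE-witness of $\mathcal{C}$ if: (W1) there is no infinite path of body transitions from $v_s$; (W2) for all vertices $v$ and all $\alpha\ge 1$ such that an $\alpha$-entry transition departs from $v$: (a) $\mathcal{C}_{\hat{\mathcal{C}}}(v,\alpha)$ is a loop chart; and (b) from no vertex $w\neq v$ of $\mathcal{C}_{\hat{\mathcal{C}}}(v,\alpha)$ does there depart a $\beta$-entry transition with $\beta\ge\alpha$. A LLEE-chart is a chart that has a LLEE-witness. Theorem. The bisimulation collapse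 of a LLEE-chart is again a LLEE-chart. -/

import Mathlib

universe u w

/-- A finite sink-termination chart with set of vertices `V` (finite) and transitions labelled by
actions from `A`.  `IsTick v` says that the vertex `v` is the termination vertex `√`; there is at
most one such vertex, possibly none.  Charts are start-vertex connected. -/
structure Chart (V : Type u) (A : Type w) where
  finite : Finite V
  IsTick : V → Prop
  start : V
  /-- `tr x a y` says that `(x, a, y)` is a transition. -/
  tr : V → A → V → Prop
  tick_unique : ∀ x y, IsTick x → IsTick y → x = y
  tick_sink : ∀ x a y, IsTick x → ¬ tr x a y
  start_not_tick : ¬ IsTick start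
  connected : ∀ x, Relation.ReflTransGen (fun y z => ∃ a, tr y a z) start x

/-- `p` is an infinite path from `x` of steps in the relation `R`. -/
def IsInfinitePath {V : Type u} (R : V → V → Prop) (x : V) (p : ℕ → V) : Prop :=
  p 0 = x ∧ ∀ n, R (p n) (p (n + 1))

/-- `B` is a bisimulation between the charts `C₁` and `C₂`. -/
structure IsBisimulation {V₁ V₂ : Type*} {A : Type*} (C₁ : Chart V₁ A) (C₂ : Chart V₂ A)
    (B : V₁ → V₂ → Prop) : Prop where
  start : B C₁.start C₂.start
  forth : ∀ x y, B x y → ∀ a x', C₁.tr x a x' → ∃ y', C₂.tr y a y' ∧ B x' y'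
  back : ∀ x y, B x y → ∀ a y', C₂.tr y a y' → ∃ x', C₁.tr x a x' ∧ B x' y'
  termination : ∀ x y, B x y → (C₁.IsTick x ↔ C₂.IsTick y)

namespace Chart

variable {V : Type u} {A : Type w}

/-- There is a transition from `x` to `y`. -/
def Step (C : Chart V A) (x y : V) : Prop := ∃ a, C.tr x a y

/-- Bisimilarity of vertices of `C`: the largest bisimulation between `C` and itself. -/
def VertexBisimilar (C : Chart V A) (x y : V) : Prop :=
  ∃ B : V → V → Prop, IsBisimulation C C B ∧ B x y

theorem vertexBisimilar_equivalence (C : Chart V A) : Equivalence C.VertexBisimilar where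
  refl x := ⟨Eq,
    { start := rfl
      forth := by rintro x _ rfl a x' h; exact ⟨x', h, rfl⟩
      back := by rintro x _ rfl a x' h; exact ⟨x', h, rfl⟩
      termination := by rintro x _ rfl; rfl }, rfl⟩
  symm := by
    rintro x y ⟨B, hB, hxy⟩
    exact ⟨fun x y => B y x,
      { start := hB.start
        forth := fun x y h => hB.back y x h
        back := fun x y h => hB.forth y x h
        termination := fun x y h => (hB.termination y x h).symm }, hxy⟩
  trans := by
    rintro x y z ⟨B, hB, hxy⟩ ⟨B', hB', hyz⟩
    refine ⟨fun x z => ∃ y, B x y ∧ B' y z,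
      { start := ⟨_, hB.start, hB'.start⟩
        forth := ?_
        back := ?_
        termination := ?_ }, y, hxy, hyz⟩
    · rintro x z ⟨y, h, h'⟩ a x' ht
      obtain ⟨y', hy, hy'⟩ := hB.forth x y h a x' ht
      obtain ⟨z', hz, hz'⟩ := hB'.forth y z h' a y' hy
      exact ⟨z', hz, y', hy', hz'⟩
    · rintro x z ⟨y, h, h'⟩ a z' ht
      obtain ⟨y', hy, hy'⟩ := hB'.back y z h' a z' ht
      obtain ⟨x', hx, hx'⟩ := hB.back x y h a y' hy
      exact ⟨x', hx, y', hx', hy'⟩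
    · rintro x z ⟨y, h, h'⟩
      exact (hB.termination x y h).trans (hB'.termination y z h')

/-- Bisimilarity of the vertices of `C`, as an equivalence relation. -/
def bisimSetoid (C : Chart V A) : Setoid V := ⟨C.VertexBisimilar, C.vertexBisimilar_equivalence⟩

/-- The bisimulation collapse of `C`: the quotient of `C` by bisimilarity of vertices. -/
def collapse (C : Chart V A) : Chart (Quotient C.bisimSetoid) A where
  finite := by
    have := C.finite
    infer_instance
  IsTick q := ∃ x, Quotient.mk C.bisimSetoid x = q ∧ C.IsTick x
  start := Quotient.mk C.bisimSetoid C.start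
  tr q a q' := ∃ x y, Quotient.mk C.bisimSetoid x = q ∧ Quotient.mk C.bisimSetoid y = q' ∧
    C.tr x a y
  tick_unique := by
    rintro _ _ ⟨x, rfl, hx⟩ ⟨y, rfl, hy⟩
    rw [C.tick_unique x y hx hy]
  tick_sink := by
    rintro _ a _ ⟨x, rfl, hx⟩ ⟨y, z, hy, -, ht⟩
    obtain ⟨B, hB, hyx⟩ : C.VertexBisimilar y x := Quotient.exact hy
    exact C.tick_sink y a z ((hB.termination y x hyx).2 hx) ht
  start_not_tick := by
    rintro ⟨x, hx, ht⟩
    obtain ⟨B, hB, hxs⟩ : C.VertexBisimilar x C.start := Quotient.exact hx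
    exact C.start_not_tick ((hB.termination _ _ hxs).1 ht)
  connected := by
    intro q
    induction q using Quotient.inductionOn with
    | _ x =>
      induction C.connected x with
      | refl => exact Relation.ReflTransGen.refl
      | tail _ h ih => exact ih.tail (h.imp fun a h => ⟨_, _, rfl, rfl, h⟩)

/-- Loop charts. -/
structure IsLoopChart (L : Chart V A) : Prop where
  /-- There is an infinite path from the start vertex. -/
  exists_path : ∃ p, IsInfinitePath L.Step L.start p
  /-- Every infinite path from the start vertex returns to it after a positive number of steps. -/
  returns : ∀ p, IsInfinitePath L.Step L.start p → ∃ n, 0 < n ∧ p n = L.start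
  /-- The termination vertex is not among the vertices. -/
  no_tick : ∀ x, ¬ L.IsTick x

/-- The entry/body-labeling of `C` by `m`: the transition `(x, a, y)` of `C` gets the marking label
`m x a y`.  The values of `m` on triples that are not transitions of `C` play no role. -/
def labeling (C : Chart V A) (m : V → A → V → ℕ) : Chart V (A × ℕ) where
  finite := C.finite
  IsTick := C.IsTick
  start := C.start
  tr x b y := C.tr x b.1 y ∧ m x b.1 y = b.2
  tick_unique := C.tick_unique
  tick_sink x b y hx h := C.tick_sink x b.1 y hx h.1
  start_not_tick := C.start_not_tick
  connected x := by
    induction C.connected x with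
    | refl => exact Relation.ReflTransGen.refl
    | @tail y z _ h ih => exact ih.tail (h.elim fun a h => ⟨(a, m y a z), h, rfl⟩)

variable (C : Chart V A) (m : V → A → V → ℕ)

/-- There is a body transition (marking label `0`) from `x` to `y` in the labeling. -/
def BodyStep (x y : V) : Prop := ∃ a, (C.labeling m).tr x (a, 0) y

/-- `(v, α)` is an entry transition identifier: `α` is positive, and an entry transition
with marking label `α` departs from `v`. -/
def IsEntry (v : V) (α : ℕ) : Prop := 0 < α ∧ ∃ a y, (C.labeling m).tr v (a, α) y

/-- The ends of the (non-empty) paths that start with an `α`-transition from `v`, continue with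
body transitions only, and halt immediately if `v` is revisited. -/
inductive LoopReach (v : V) (α : ℕ) : V → Prop
  | entry (a : A) (y : V) : (C.labeling m).tr v (a, α) y → LoopReach v α y
  | body (x : V) (a : A) (y : V) : LoopReach v α x → x ≠ v → (C.labeling m).tr x (a, 0) y →
      LoopReach v α y

/-- For an entry transition identifier `(v, α)`, the subchart of `C` with start vertex `v` that
consists of the vertices and transitions on the paths that start with an `α`-entry transition
from `v`, continue with body transitions only, and halt immediately if `v` is revisited. -/
def entrySubchart (v : V) (α : ℕ) (h : C.IsEntry m v α) :
    Chart {x : V // x = v ∨ C.LoopReach m v α x} A where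
  finite := by
    have := C.finite
    infer_instance
  IsTick x := C.IsTick x
  start := ⟨v, Or.inl rfl⟩
  tr x a y := ((x : V) = v ∧ (C.labeling m).tr x (a, α) y) ∨
    ((x : V) ≠ v ∧ (C.labeling m).tr x (a, 0) y)
  tick_unique x y hx hy := Subtype.ext (C.tick_unique x y hx hy)
  tick_sink x a y hx ht := by
    rcases ht with ⟨-, ht⟩ | ⟨-, ht⟩
    · exact (C.labeling m).tick_sink _ _ _ hx ht
    · exact (C.labeling m).tick_sink _ _ _ hx ht
  start_not_tick hv := by
    obtain ⟨-, a, y, ht⟩ := h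
    exact (C.labeling m).tick_sink _ _ _ hv ht
  connected := by
    rintro ⟨x, hx⟩
    by_cases hxv : x = v
    · subst hxv
      exact Relation.ReflTransGen.refl
    · have hr : C.LoopReach m v α x := hx.resolve_left hxv
      clear hxv
      induction hr with
      | entry a y ht => exact Relation.ReflTransGen.single ⟨a, Or.inl ⟨rfl, ht⟩⟩
      | body z a y hz hzv ht ih =>
        exact Relation.ReflTransGen.tail (ih (Or.inr hz)) ⟨a, Or.inr ⟨hzv, ht⟩⟩

/-- The entry/body-labeling of `C` by `m` is a LLEE-witness of `C`. -/
structure IsLLEEWitness : Prop where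
  /-- There is no infinite path of body transitions from the start vertex. -/
  no_body_path : ¬ ∃ p, IsInfinitePath (C.BodyStep m) C.start p
  /-- Every entry transition identifier generates a loop chart. -/
  loop : ∀ v α (h : C.IsEntry m v α), (C.entrySubchart m v α h).IsLoopChart
  /-- Layeredness: from no vertex other than `v` of the subchart of `(v, α)` does an entry
  transition of level at least `α` depart. -/
  layered : ∀ v α, C.IsEntry m v α → ∀ x : {x : V // x = v ∨ C.LoopReach m v α x},
    (x : V) ≠ v → ∀ β, α ≤ β → ¬ C.IsEntry m x β

/-- A LLEE-chart is a chart that has a LLEE-witness. -/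
def IsLLEE : Prop := ∃ m : V → A → V → ℕ, C.IsLLEEWitness m

end Chart

/-! A witness need not descend to the quotient, so it is replaced by a label-free property that
does: `LoopReducible`, asking that every set of steps with an infinite path contain a step `v → y`
such that all paths from `y` inside the set, halted at `v`, are finite and do not terminate before
`v`.

A witness yields this property (`IsLLEEWitness.loopReducible`): in the given set, take an entry step
of least positive label. Layeredness and minimality force the paths after it to use body steps only
until `v` is reached.

The property passes to the collapse (`LoopReducible.collapse`) because steps of the quotient lift to
every representative: a set of steps pulls back to the chart, infinite paths lift, and safety
projects down.

Conversely, the property rebuilds a witness (`LoopReducible.isLLEE`). Steps that open a loop are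
removed one at a time, each receiving a new largest label, until no infinite path remains.
Layeredness survives if the new loop starts outside all loops removed earlier;
`IsLayering.exists_outermost` shows that such a choice exists. -/

namespace Chart

/-! ### Safety and well-foundedness along paths of a relation -/

section Relation

variable {V : Type*}

/-- `H` restricted to the steps that do not depart from `v`. -/
def StepAvoiding (H : V → V → Prop) (v x y : V) : Prop := H x y ∧ x ≠ v

/-- Every `H`-path from a vertex that halts at `v` is finite and has no vertex satisfying `T`
before it reaches `v`. -/
inductive Safe (T : V → Prop) (H : V → V → Prop) (v : V) : V → Prop
  | base : Safe T H v v
  | step (x : V) : ¬ T x → (∀ y, H x y → Safe T H v y) → Safe T H v x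

variable {T : V → Prop} {H K : V → V → Prop} {v w x y z : V}

theorem Safe.not_tick (h : Safe T H v x) (hx : x ≠ v) : ¬ T x := by
  cases h with
  | base => exact absurd rfl hx
  | step _ h _ => exact h

theorem Safe.succ (h : Safe T H v x) (hx : x ≠ v) (hxy : H x y) : Safe T H v y := by
  cases h with
  | base => exact absurd rfl hx
  | step _ _ h => exact h y hxy

theorem Safe.mono (hHK : ∀ x y, K x y → H x y) (h : Safe T H v x) : Safe T K v x := by
  induction h with
  | base => exact .base
  | step x hx _ ih => exact .step x hx fun y hy => ih y (hHK x y hy)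

theorem Safe.reach (h : Safe T H v x) (hxy : Relation.ReflTransGen (StepAvoiding H v) x y) :
    Safe T H v y := by
  induction hxy with
  | refl => exact h
  | tail _ hs ih => exact ih.succ hs.2 hs.1

theorem Safe.trans (h : Safe T H w x) (hw : Safe T H v w) : Safe T H v x := by
  induction h with
  | base => exact hw
  | step x hx _ ih => exact .step x hx ih

theorem Safe.acc (h : Safe T H v x) : Acc (Function.swap (StepAvoiding H v)) x := by
  induction h with
  | base => exact ⟨_, fun y hy => absurd rfl hy.2⟩
  | step x _ _ ih => exact ⟨_, fun y hy => ih y hy.1⟩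

theorem Safe.acc_of_acc (h : Safe T H v x) (hv : Acc (Function.swap H) v) :
    Acc (Function.swap H) x := by
  induction h with
  | base => exact hv
  | step x _ _ ih => exact ⟨_, fun y hy => ih y hy⟩

/-- If `v` is not reachable from `x`, then safety of `x` does not depend on `v`. -/
theorem Safe.of_not_reach (h : Safe T H v x) (hv : ¬ Relation.ReflTransGen H x v) :
    Safe T H w x ∧ Acc (Function.swap H) x := by
  induction h with
  | base => exact absurd .refl hv
  | step x hx _ ih =>
    have ih' := fun y hy => ih y hy fun hr => hv (hr.head hy)
    exact ⟨.step x hx fun y hy => (ih' y hy).1, ⟨_, fun y hy => (ih' y hy).2⟩⟩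

theorem not_transGen_self_of_acc (h : Acc (Function.swap H) x) : ¬ Relation.TransGen H x x := by
  induction h with
  | intro x _ ih =>
    intro hx
    obtain ⟨y, hxy, hyx⟩ := Relation.TransGen.head'_iff.1 hx
    exact ih y hxy (Relation.TransGen.tail' hyx hxy)

theorem reach_mono (hHK : ∀ x y, K x y → H x y) (h : Relation.ReflTransGen K x y) :
    Relation.ReflTransGen H x y := by
  induction h with
  | refl => exact .refl
  | tail _ hs ih => exact ih.tail (hHK _ _ hs)

theorem reach_avoiding_target (h : Relation.ReflTransGen H x v) :
    Relation.ReflTransGen (StepAvoiding H v) x v := by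
  induction h using Relation.ReflTransGen.head_induction_on with
  | refl => exact .refl
  | @head a b hab _ ih =>
    by_cases ha : a = v
    · rw [ha]
    · exact ih.head ⟨hab, ha⟩

theorem reach_through_or_avoiding (h : Relation.ReflTransGen H x y) (v : V) :
    (Relation.ReflTransGen H x v ∧ Relation.ReflTransGen H v y) ∨
      Relation.ReflTransGen (StepAvoiding H v) x y := by
  induction h using Relation.ReflTransGen.head_induction_on with
  | refl => exact .inr .refl
  | @head a b hab hby ih =>
    by_cases ha : a = v
    · subst ha
      exact .inl ⟨.refl, hby.head hab⟩
    · exact ih.imp (fun h => ⟨h.1.head hab, h.2⟩) fun h => h.head ⟨hab, ha⟩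

/-- The relation `H` without the step from `v` to `y`. -/
def eraseStep (H : V → V → Prop) (v y a b : V) : Prop := H a b ∧ ¬ (a = v ∧ b = y)

theorem eraseStep_lt (h : H v y) : eraseStep H v y < H := by
  refine lt_of_le_of_ne (fun a b hab => hab.1) fun he => ?_
  rw [← he] at h
  exact h.2 ⟨rfl, rfl⟩

theorem exists_path_of_not_acc {P : V → Prop} (hP : ∀ x, P x → ∃ y, H x y ∧ P y) (hx : P x) :
    ∃ p, IsInfinitePath H x p ∧ ∀ n, P (p n) := by
  choose f hf using fun x : {x // P x} => hP x.1 x.2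
  let g : {x // P x} → {x // P x} := fun x => ⟨f x, (hf x).2⟩
  refine ⟨fun n => (g^[n] ⟨x, hx⟩ : {x // P x}), ⟨rfl, fun n => ?_⟩, fun n => Subtype.prop _⟩
  simp only [Function.iterate_succ_apply']
  exact (hf _).1

theorem acc_of_no_path (h : ¬ ∃ p, IsInfinitePath H x p) : Acc (Function.swap H) x := by
  by_contra hx
  obtain ⟨p, hp, -⟩ := exists_path_of_not_acc (H := H) (P := fun x => ¬ Acc (Function.swap H) x)
    (fun x hx => by
      by_contra! hn
      exact hx ⟨_, fun y hy => hn y hy⟩) hx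
  exact h ⟨p, hp⟩

theorem not_infinitePath_of_acc (h : Acc (Function.swap H) x) (p : ℕ → V) :
    ¬ IsInfinitePath H x p := by
  induction h generalizing p with
  | intro x _ ih =>
    rintro ⟨rfl, hp⟩
    exact ih (p 1) (hp 0) (fun n => p (n + 1)) ⟨rfl, fun n => hp (n + 1)⟩

theorem Safe.path_returns (h : Safe T H v x) (p : ℕ → V) (hp : p 0 = x)
    (hs : ∀ n, p n ≠ v → H (p n) (p (n + 1))) : ∃ n, p n = v := by
  by_contra! hn
  exact not_infinitePath_of_acc h.acc p ⟨hp, fun n => ⟨hs n (hn n), hn n⟩⟩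

end Relation

variable {V : Type*} {A : Type*}

/-- Every set of steps of `C` that admits an infinite path contains a step from some `v` to a
vertex from which all paths in this set are finite and do not terminate unless they visit `v`. -/
def LoopReducible (C : Chart V A) : Prop :=
  ∀ H : V → V → Prop, (∀ x y, H x y → C.Step x y) → ¬ WellFounded (Function.swap H) →
    ∃ v y, H v y ∧ Safe C.IsTick H v y

/-! ### From a LLEE-witness to loop reducibility -/

section Witness

variable {C : Chart V A} {m : V → A → V → ℕ}

/-- If safety failed at `y`, failure would propagate along body steps for ever without meeting `v`,
giving an infinite path of the loop chart that never returns. -/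
theorem IsLLEEWitness.safe_body (hm : C.IsLLEEWitness m) {v y : V} {α : ℕ} (hα : 0 < α) {a : A}
    (h : (C.labeling m).tr v (a, α) y) : Safe C.IsTick (C.BodyStep m) v y := by
  have he : C.IsEntry m v α := ⟨hα, a, y, h⟩
  have hL := hm.loop v α he
  by_contra hy
  let S := C.entrySubchart m v α he
  obtain ⟨p, ⟨hp0, hp⟩, hpP⟩ := exists_path_of_not_acc (H := S.Step)
    (P := fun x => C.LoopReach m v α x ∧ ¬ Safe C.IsTick (C.BodyStep m) v x)
    (x := ⟨y, .inr (.entry a y h)⟩) (by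
      rintro ⟨x, hx'⟩ ⟨hx, hs⟩
      have hxv : x ≠ v := by
        rintro rfl
        exact hs .base
      obtain ⟨z, hxz, hz⟩ : ∃ z, C.BodyStep m x z ∧ ¬ Safe C.IsTick (C.BodyStep m) v z := by
        by_contra! hn
        exact hs (.step x (hL.no_tick ⟨x, hx'⟩) hn)
      obtain ⟨b, hb⟩ := hxz
      have hr : C.LoopReach m v α z := .body x b z hx hxv hb
      exact ⟨⟨z, .inr hr⟩, ⟨b, .inr ⟨hxv, hb⟩⟩, hr, hz⟩) ⟨.entry a y h, hy⟩
  -- The entry step is put in front, since the loop condition concerns paths from the start vertex.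
  let q : ℕ → {x : V // x = v ∨ C.LoopReach m v α x} := fun n => n.casesOn S.start p
  have hq : IsInfinitePath S.Step S.start q := by
    refine ⟨rfl, fun n => ?_⟩
    cases n with
    | zero =>
      change S.Step S.start (p 0)
      rw [hp0]
      exact ⟨a, .inl ⟨rfl, h⟩⟩
    | succ n => exact hp n
  obtain ⟨n, hn, hqn⟩ := hL.returns q hq
  obtain ⟨k, rfl⟩ := Nat.exists_eq_succ_of_ne_zero hn.ne'
  have hk : p k = S.start := hqn
  have := (hpP k).2
  rw [hk] at this
  exact this .base

/-- (W1) covers only the start vertex. Accessibility spreads to all vertices along transitions: body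
steps inherit it, and after an entry step every body path stops or comes back to the source, which
is already accessible. -/
theorem IsLLEEWitness.wellFounded_body (hm : C.IsLLEEWitness m) :
    WellFounded (Function.swap (C.BodyStep m)) := by
  refine ⟨fun x => ?_⟩
  induction C.connected x with
  | refl => exact acc_of_no_path hm.no_body_path
  | @tail y z _ h ih =>
    obtain ⟨a, h⟩ := h
    rcases Nat.eq_zero_or_pos (m y a z) with h0 | h0
    · exact ih.inv ⟨a, h, h0⟩
    · exact (hm.safe_body h0 ⟨h, rfl⟩).acc_of_acc ih

theorem IsLLEEWitness.loopReducible (hm : C.IsLLEEWitness m) : C.LoopReducible := by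
  classical
  intro H hH hwf
  have hex : ∃ α, 0 < α ∧ ∃ v a y, H v y ∧ C.tr v a y ∧ m v a y = α := by
    by_contra! hn
    refine hwf (Subrelation.wf (fun {x y} hxy => ?_) hm.wellFounded_body)
    obtain ⟨a, ha⟩ := hH _ _ hxy
    refine ⟨a, ha, ?_⟩
    by_contra h0
    exact hn _ (Nat.pos_of_ne_zero h0) _ a _ hxy ha rfl
  obtain ⟨hα, v, a, y, hvy, ha, hm'⟩ := Nat.find_spec hex
  have hmin := fun β => Nat.find_min' hex (m := β)
  generalize Nat.find hex = α at *
  refine ⟨v, y, hvy, ?_⟩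
  have hs := hm.safe_body hα ⟨ha, hm'⟩
  have hr : C.LoopReach m v α y := .entry a y ⟨ha, hm'⟩
  have he : C.IsEntry m v α := ⟨hα, a, y, ha, hm'⟩
  clear hvy ha hm'
  induction hs with
  | base => exact .base
  | step x hx _ ih =>
    by_cases hxv : x = v
    · rw [hxv]
      exact .base
    refine .step x hx fun z hxz => ?_
    obtain ⟨b, hb⟩ := hH _ _ hxz
    -- A positive label here would be at least `α` by minimality, which layeredness forbids inside
    -- the loop.
    have h0 : m x b z = 0 := by
      by_contra h0
      have h0 := Nat.pos_of_ne_zero h0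
      exact hm.layered v α he ⟨x, .inr hr⟩ hxv _ (hmin _ ⟨h0, x, b, z, hxz, hb, rfl⟩)
        ⟨h0, b, z, hb, rfl⟩
    exact ih z ⟨b, hb, h0⟩ (.body x b z hr hxv ⟨hb, h0⟩)

end Witness

/-! ### Loop reducibility passes to the collapse -/

section Collapse

variable {C : Chart V A}

theorem VertexBisimilar.tick_iff {x y : V} (h : C.VertexBisimilar x y) :
    C.IsTick x ↔ C.IsTick y := by
  obtain ⟨B, hB, hxy⟩ := h
  exact hB.termination x y hxy

theorem collapse_step_lift {x : V} {q : Quotient C.bisimSetoid}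
    (h : C.collapse.Step (Quotient.mk C.bisimSetoid x) q) :
    ∃ y, C.Step x y ∧ Quotient.mk C.bisimSetoid y = q := by
  obtain ⟨a, x', y', hx, rfl, ht⟩ := h
  obtain ⟨B, hB, hxx⟩ : C.VertexBisimilar x' x := Quotient.exact hx
  obtain ⟨y, hy, hyy⟩ := hB.forth _ _ hxx a y' ht
  exact ⟨y, ⟨a, hy⟩, (Quotient.sound (s := C.bisimSetoid) ⟨B, hB, hyy⟩).symm⟩

theorem LoopReducible.collapse (hC : C.LoopReducible) : C.collapse.LoopReducible := by
  intro H hH hwf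
  -- The full preimage of `H`: it must contain a lift of each `H`-step at every representative, both
  -- to lift infinite paths and to project safety.
  let K : V → V → Prop := fun x y =>
    C.Step x y ∧ H (Quotient.mk C.bisimSetoid x) (Quotient.mk C.bisimSetoid y)
  have lift : ∀ x q, H (Quotient.mk C.bisimSetoid x) q →
      ∃ y, K x y ∧ Quotient.mk C.bisimSetoid y = q := by
    intro x q hq
    obtain ⟨y, hy, rfl⟩ := collapse_step_lift (hH _ _ hq)
    exact ⟨y, ⟨hy, hq⟩, rfl⟩
  obtain ⟨v, y, hvy, hs⟩ := hC K (fun x y h => h.1) fun hK => hwf ⟨fun q => by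
    induction q using Quotient.inductionOn with
    | _ x =>
      induction hK.apply x with
      | intro x _ ih =>
        refine ⟨_, fun q hq => ?_⟩
        obtain ⟨y, hy, rfl⟩ := lift x q hq
        exact ih y hy⟩
  refine ⟨_, _, hvy.2, ?_⟩
  clear hvy
  induction hs with
  | base => exact .base
  | step x hx _ ih =>
    refine .step _ ?_ fun q hq => ?_
    · rintro ⟨x', hxx, hx'⟩
      exact hx ((VertexBisimilar.tick_iff (Quotient.exact hxx)).1 hx')
    · obtain ⟨y, hy, rfl⟩ := lift x q hq
      exact ih y hy

end Collapse

/-! ### From loop reducibility to a LLEE-witness -/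

section Construction

variable {C : Chart V A}

/-- A safe step that cannot return leads only to finite paths. Deleting it keeps the infinite paths,
and restoring it later does no harm to safety, so induction on the finite set of steps applies. -/
theorem LoopReducible.exists_returning (hC : C.LoopReducible) (H : V → V → Prop)
    (hH : ∀ x y, H x y → C.Step x y) (hwf : ¬ WellFounded (Function.swap H)) :
    ∃ v y, H v y ∧ Safe C.IsTick H v y ∧ Relation.ReflTransGen H y v := by
  have := C.finite
  induction H using WellFoundedLT.induction with
  | _ H ih =>
    obtain ⟨v, y, hvy, hs⟩ := hC H hH hwf
    by_cases hr : Relation.ReflTransGen H y v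
    · exact ⟨v, y, hvy, hs, hr⟩
    obtain ⟨w, z, hwz, hsz, hrz⟩ := ih (eraseStep H v y) (eraseStep_lt hvy)
      (fun a b h => hH a b h.1) fun hK => hwf ⟨fun x => by
        induction hK.apply x with
        | intro x _ ih =>
          refine ⟨_, fun b hb => ?_⟩
          by_cases hx : x = v ∧ b = y
          · rw [hx.2]
            exact (hs.of_not_reach (w := v) hr).2
          · exact ih b ⟨hb, hx⟩⟩
    refine ⟨w, z, hwz.1, ?_, reach_mono (fun a b h => h.1) hrz⟩
    clear hwz hrz
    induction hsz with
    | base => exact .base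
    | step x hx _ ih =>
      refine .step x hx fun b hb => ?_
      by_cases hx : x = v ∧ b = y
      · rw [hx.2]
        exact (hs.of_not_reach hr).1
      · exact ih b ⟨hb, hx⟩

/-- A labeling of the steps of `C`, by positive labels at most `n` outside of the set `H` of
remaining steps, as it arises by eliminating loops from `C` layer by layer. -/
structure IsLayering (C : Chart V A) (H : V → V → Prop) (l : V → V → ℕ) (n : ℕ) : Prop where
  remaining : ∀ x y, H x y ↔ C.Step x y ∧ l x y = 0
  le : ∀ x y, l x y ≤ n
  safe : ∀ x y, 0 < l x y → Safe C.IsTick H x y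
  returning : ∀ x y, 0 < l x y → Relation.ReflTransGen (StepAvoiding H x) y x
  layered : ∀ x y, 0 < l x y → ∀ w, Relation.ReflTransGen (StepAvoiding H x) y w → w ≠ x →
    ∀ z, l w z < l x y

variable {H : V → V → Prop} {l : V → V → ℕ} {n : ℕ}

/-- A loop at a vertex inside of an already eliminated loop at `v` can be exchanged for a loop
at `v`. -/
theorem exists_safe_at_outer {v w z : V} (hvw : w ≠ v) (hs : Safe C.IsTick H v w) (hwz : H w z)
    (hz : Safe C.IsTick H w z) (hr : Relation.ReflTransGen H z w) :
    ∃ y, H v y ∧ Safe C.IsTick H v y ∧ Relation.ReflTransGen H y v := by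
  -- The cycle through `w` must visit `v`, since a cycle avoiding `v` contradicts the safety of `w`.
  -- The step by which the cycle leaves `v` is the one sought: paths from its target are caught at
  -- `w`, and from there at `v`.
  rcases reach_through_or_avoiding (reach_avoiding_target hr) v with ⟨h₁, h₂⟩ | h
  · rcases Relation.ReflTransGen.cases_head h₂ with h | ⟨y, hvy, hyw⟩
    · exact absurd h.symm hvw
    have toH : ∀ a b, StepAvoiding H w a b → H a b := fun a b h => h.1
    exact ⟨y, hvy.1, ((hz.reach h₁).succ hvw.symm hvy.1).trans hs,
      (reach_mono toH hyw).trans ((reach_mono toH h₁).head hwz)⟩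
  · exact absurd (Relation.TransGen.head' ⟨hwz, hvw⟩ (reach_mono (fun a b h => ⟨h.1.1, h.2⟩) h))
      (not_transGen_self_of_acc hs.acc)

/-- Otherwise each returning loop could be exchanged for one at the base of an enclosing removed
loop. By layeredness the labels departing from successive bases grow strictly, exceeding the bound
`n`. -/
theorem IsLayering.exists_outermost (hC : C.LoopReducible) (h : IsLayering C H l n)
    (hwf : ¬ WellFounded (Function.swap H)) :
    ∃ w z, H w z ∧ Safe C.IsTick H w z ∧ Relation.ReflTransGen H z w ∧
      ∀ x y, 0 < l x y → w ≠ x → ¬ Relation.ReflTransGen (StepAvoiding H x) y w := by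
  by_contra! hn
  obtain ⟨w, z, hwz, hs, hr⟩ := hC.exists_returning H (fun x y hxy => ((h.remaining x y).1 hxy).1)
    hwf
  have large : ∀ k, ∃ x y, k < l x y ∧
      ∃ z, H x z ∧ Safe C.IsTick H x z ∧ Relation.ReflTransGen H z x := by
    intro k
    induction k with
    | zero =>
      obtain ⟨x, y, hxy, hwx, hb⟩ := hn w z hwz hs hr
      exact ⟨x, y, hxy, exists_safe_at_outer hwx ((h.safe x y hxy).reach hb) hwz hs hr⟩
    | succ k ih =>
      obtain ⟨v, u, hk, z, hvz, hs, hr⟩ := ih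
      obtain ⟨x, y, hxy, hvx, hb⟩ := hn v z hvz hs hr
      have := h.layered x y hxy v hb hvx u
      exact ⟨x, y, by omega, exists_safe_at_outer hvx ((h.safe x y hxy).reach hb) hvz hs hr⟩
  obtain ⟨x, y, hxy, -⟩ := large n
  exact absurd (h.le x y) (by omega)

open Classical in
-- The label `n + 1` exceeds all labels inside the new loop. Older loops based elsewhere do not
-- contain `w`, so they neither lose a step nor meet the new label; those based at `w` may share it
-- as base.
theorem IsLayering.erase (h : IsLayering C H l n) {w z : V}
    (hs : Safe C.IsTick H w z) (hr : Relation.ReflTransGen H z w)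
    (hout : ∀ x y, 0 < l x y → w ≠ x → ¬ Relation.ReflTransGen (StepAvoiding H x) y w) :
    IsLayering C (eraseStep H w z) (fun a b => if a = w ∧ b = z then n + 1 else l a b) (n + 1) := by
  have hsub : ∀ a b, eraseStep H w z a b → H a b := fun a b h => h.1
  have hsub' : ∀ v a b, StepAvoiding (eraseStep H w z) v a b → StepAvoiding H v a b :=
    fun v a b h => ⟨h.1.1, h.2⟩
  have hle := h.le
  refine ⟨fun x y => ?_, fun x y => ?_, fun x y hxy => ?_, fun x y hxy => ?_,
    fun x y hxy u hu hux b => ?_⟩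
  · by_cases hc : x = w ∧ y = z
    · simp [eraseStep, hc]
    · simp [eraseStep, hc, h.remaining]
  · have := hle x y
    split_ifs <;> omega
  · by_cases hc : x = w ∧ y = z
    · rw [hc.1, hc.2]
      exact hs.mono hsub
    · exact (h.safe x y (by simpa [hc] using hxy)).mono hsub
  · by_cases hc : x = w ∧ y = z
    · rw [hc.1, hc.2]
      -- A path halted at `w` never uses the erased step, which departs from `w`.
      exact reach_mono (fun a b h => ⟨⟨h.1, fun h' => h.2 h'.1⟩, h.2⟩) (reach_avoiding_target hr)
    · have hxy : 0 < l x y := by simpa [hc] using hxy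
      have persist : ∀ u, Relation.ReflTransGen (StepAvoiding H x) y u →
          Relation.ReflTransGen (StepAvoiding (eraseStep H w z) x) y u := by
        intro u hu
        induction hu with
        | refl => exact .refl
        | @tail a b hya hab ih =>
          refine ih.tail ⟨⟨hab.1, ?_⟩, hab.2⟩
          rintro ⟨haw, -⟩
          exact hout x y hxy (haw ▸ hab.2) (haw ▸ hya)
      exact persist x (h.returning x y hxy)
  · have hu := reach_mono (hsub' x) hu
    by_cases hc : x = w ∧ y = z
    · have huw : u ≠ w := by rwa [← hc.1]
      have := hle u b
      simp only [hc, huw, and_self, if_true, false_and, if_false]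
      omega
    · have hxy : 0 < l x y := by simpa [hc] using hxy
      have huw : u ≠ w := by
        intro huw
        exact hout x y hxy (huw ▸ hux) (huw ▸ hu)
      simpa [hc, huw] using h.layered x y hxy u hu hux b

theorem IsLayering.exists_complete (hC : C.LoopReducible) (h : IsLayering C H l n) :
    ∃ H l n, IsLayering C H l n ∧ WellFounded (Function.swap H) := by
  have := C.finite
  induction H using WellFoundedLT.induction generalizing l n with
  | _ H ih =>
    by_cases hwf : WellFounded (Function.swap H)
    · exact ⟨H, l, n, h, hwf⟩
    obtain ⟨w, z, hwz, hs, hr, hout⟩ := h.exists_outermost hC hwf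
    exact ih _ (eraseStep_lt hwz) (h.erase hs hr hout)

theorem IsLayering.reach_of_loopReach (h : IsLayering C H l n) {v x : V} {α : ℕ}
    (hr : C.LoopReach (fun x _ y => l x y) v α x) :
    ∃ y, l v y = α ∧ Relation.ReflTransGen (StepAvoiding H v) y x := by
  induction hr with
  | entry a y ht => exact ⟨y, ht.2, .refl⟩
  | body x a z _ hxv ht ih =>
    obtain ⟨y, hy, hyx⟩ := ih
    exact ⟨y, hy, hyx.tail ⟨(h.remaining x z).2 ⟨⟨a, ht.1⟩, ht.2⟩, hxv⟩⟩

theorem IsLayering.isLoopChart (h : IsLayering C H l n) {v : V} {α : ℕ}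
    (he : C.IsEntry (fun x _ y => l x y) v α) :
    (C.entrySubchart (fun x _ y => l x y) v α he).IsLoopChart := by
  refine ⟨?_, fun p hp => ?_, ?_⟩
  · let S := C.entrySubchart _ v α he
    obtain ⟨hα, a, y, ht, hl⟩ := id he
    have hl : l v y = α := hl
    have hret := h.returning v y (hl ▸ hα)
    have hback : ∀ x, Relation.ReflTransGen (StepAvoiding H v) x v →
        ∀ hx : C.LoopReach (fun x _ y => l x y) v α x,
        Relation.ReflTransGen S.Step ⟨x, .inr hx⟩ S.start := by
      intro x hxv
      induction hxv using Relation.ReflTransGen.head_induction_on with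
      | refl => exact fun _ => .refl
      | @head a b hab _ ih =>
        intro ha
        obtain ⟨hstep, h0⟩ := (h.remaining a b).1 hab.1
        obtain ⟨c, hc⟩ := hstep
        exact (ih (.body a c b ha hab.2 ⟨hc, h0⟩)).head ⟨c, .inr ⟨hab.2, hc, h0⟩⟩
    have hr : C.LoopReach (fun x _ y => l x y) v α y := .entry a y ⟨ht, hl⟩
    have hfirst : S.Step S.start ⟨y, .inr hr⟩ := ⟨a, .inl ⟨rfl, ht, hl⟩⟩
    -- A cycle through the start suffices, as it rules out accessibility and hence forces an
    -- infinite path.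
    have hcyc : Relation.TransGen S.Step S.start S.start := .head' hfirst (hback y hret hr)
    by_contra hn
    exact not_transGen_self_of_acc (acc_of_no_path hn) hcyc
  · obtain ⟨hp0, hp⟩ := hp
    obtain ⟨a, h0⟩ := hp 0
    rw [hp0] at h0
    rcases h0 with ⟨-, ht, hl⟩ | ⟨hne, -⟩
    · have hl : l v (p 1).1 = α := hl
      have hs := h.safe v (p 1).1 (hl.symm ▸ he.1 : 0 < l v (p 1).1)
      obtain ⟨k, hk⟩ := hs.path_returns (fun k => (p (k + 1)).1) rfl fun k hk => by
        obtain ⟨b, hb⟩ := hp (k + 1)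
        rcases hb with ⟨hb, -⟩ | ⟨-, hb, h0⟩
        · exact absurd hb hk
        · exact (h.remaining _ _).2 ⟨⟨b, hb⟩, h0⟩
      exact ⟨k + 1, k.succ_pos, Subtype.ext hk⟩
    · exact absurd rfl hne
  · rintro ⟨x, hx⟩ htick
    have htick : C.IsTick x := htick
    by_cases hxv : x = v
    · obtain ⟨-, a, y, ht, -⟩ := he
      exact C.tick_sink v a y (hxv ▸ htick) ht
    · obtain ⟨y, hl, hr⟩ := h.reach_of_loopReach (hx.resolve_left hxv)
      exact ((h.safe v y (hl ▸ he.1)).reach hr).not_tick hxv htick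

theorem IsLayering.isLLEEWitness (h : IsLayering C H l n) (hwf : WellFounded (Function.swap H)) :
    C.IsLLEEWitness fun x _ y => l x y where
  no_body_path := by
    rintro ⟨p, hp0, hp⟩
    refine not_infinitePath_of_acc (hwf.apply C.start) p ⟨hp0, fun k => ?_⟩
    obtain ⟨a, ha, h0⟩ := hp k
    exact (h.remaining _ _).2 ⟨⟨a, ha⟩, h0⟩
  loop _ _ he := h.isLoopChart he
  layered := by
    rintro v α he ⟨x, hx⟩ hxv β hβ ⟨-, a, z, -, hz⟩
    obtain ⟨y, hl, hr⟩ := h.reach_of_loopReach (hx.resolve_left hxv)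
    have hlt := h.layered v y (hl ▸ he.1) x hr hxv z
    have hz : l x z = β := hz
    omega

theorem LoopReducible.isLLEE (hC : C.LoopReducible) : C.IsLLEE := by
  -- Elimination starts with nothing removed; with all labels `0`, the loop conditions are vacuous.
  obtain ⟨H, l, n, h, hwf⟩ := IsLayering.exists_complete (H := C.Step) (l := fun _ _ => 0) (n := 0)
    hC ⟨by simp, by simp, by simp, by simp, by simp⟩
  exact ⟨_, h.isLLEEWitness hwf⟩

end Construction

end Chart

theorem mainTheorem2 {V : Type*} {A : Type*} (C : Chart V A) (hC : C.IsLLEE) :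
    C.collapse.IsLLEE := by
  obtain ⟨m, hm⟩ := hC
  exact hm.loopReducible.collapse.isLLEE
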